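/- **Model.** In the *rental game of length* $n\ge 0$ a designer owns one asset for $n$ days. On each day a new agent arrives with a private valuation $v$ per day of rental; the $n$ valuations are i.i.d. uniform on $[0,1]$. If the asset is available and $h$ days remain, the designer offers the current agent a *stagewise auction*: a set of bids, each mapped to a payment schedule $(p_1,\dots,p_x)$ with $0\le x\le h$ and all $p_i\ge 0$; the agent then rents the asset for $x$ days, paying $p_i$ on the $i$-th day. An agent is *stagewise individually rational*: a bid is acceptable only if $i\,v-\sum_{j\le i}p_j\ge 0$ for all $1\le i\le x$. Among the acceptable bids and the option of making no bid (zero days, zero utility), the agent chooses one maximizing the overall utility $xv-\sum_{j\le x}p_j$, ties being broken in favor of the designer. Agents arriving while the asset is rented out are turned away. A *rental mechanism* chooses the auction offered as a function of the number of remaining days and of the history of bids. It is *fixed-rate* if in every offered auction every bid has a schedule with constant payments $(p,\dots,p)$. The designer's reward is consumer surplus: the sum of $v-p$ over all days on which the asset is rented, where $v$ is the valuation of the agent renting it that day and $p$ that day's payment. **Statement.** For every $n$ there is a rental mechanism whose expected reward is maximal among all rental mechanisms (with integrable total reward), and there is a fixed-rate rental mechanism whose expected reward is maximal among all fixed-rate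 ones; let $R_n$ and $F_n$ be these optimal expected rewards. Then $F_n=n/2$ for every $n$, $$\lim_{n\to\infty}\frac{R_n}{n}=1,\qquad\text{and hence}\qquad \lim_{n\to\infty}\frac{R_n}{F_n}=2 .$$ -/

import Mathlib

open MeasureTheory Filter Topology
open scoped NNReal

/-- A (deterministic) stagewise auction of up to `n` units, one per day: the designer fixes a set
of admissible bids and maps every bid to a payment schedule `[p₁, …, pₓ]` with `x ≤ n`; the buyer
receives `x` units, the `i`-th of them on day `i` at the price `pᵢ ≥ 0`. -/
structure StagewiseAuction (n : ℕ) where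
  bids : Set ℝ≥0
  schedule : bids → List ℝ≥0
  length_le : ∀ b, (schedule b).length ≤ n

/-- The schedule that a buyer ends up with: `some b` is the bid `b`, and `none` stands for a buyer
who makes no bid at all and is turned away with zero units. -/
def StagewiseAuction.outcome {n : ℕ} (A : StagewiseAuction n) : Option A.bids → List ℝ≥0
  | none => []
  | some b => A.schedule b

/-- All units sold under one bid carry the same price. -/
def StagewiseAuction.IsFixedRate {n : ℕ} (A : StagewiseAuction n) : Prop :=
  ∀ b : A.bids, ∃ p : ℝ≥0, A.schedule b = List.replicate (A.schedule b).length p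

/-- Cumulative utility from the first `i` units of the schedule `s`, for a buyer with per-unit
valuation `v`. -/
noncomputable def cumulativeUtility (s : List ℝ≥0) (v : ℝ) (i : ℕ) : ℝ :=
  i * v - ((s.take i).map (fun p : ℝ≥0 => (p : ℝ))).sum

/-- Overall utility of a buyer with valuation `v` from the schedule `s`. -/
noncomputable def overallUtility (s : List ℝ≥0) (v : ℝ) : ℝ :=
  cumulativeUtility s v s.length

/-- Stagewise individual rationality: the cumulative utility is nonnegative after every day. -/
def StagewiseIR (s : List ℝ≥0) (v : ℝ) : Prop :=
  ∀ i : ℕ, 1 ≤ i → i ≤ s.length → 0 ≤ cumulativeUtility s v i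

/-- `b` is an optimal choice of a stagewise individually rational buyer with valuation `v`: it is
acceptable, and it maximizes the overall utility among all acceptable choices. -/
def StagewiseAuction.IsOptimalBid {n : ℕ} (A : StagewiseAuction n) (v : ℝ)
    (b : Option A.bids) : Prop :=
  StagewiseIR (A.outcome b) v ∧
    ∀ b' : Option A.bids, StagewiseIR (A.outcome b') v →
      overallUtility (A.outcome b') v ≤ overallUtility (A.outcome b) v

/-- The choices made so far by the agents who negotiated with the designer, in order of arrival. -/
abbrev History : Type := List (Option ℝ≥0)

/-- A rental mechanism: on a day on which the asset is available, with `h` days remaining and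
history `H`, it offers the stagewise auction `M h H` of up to `h` units (days) to the agent who
arrives. In a game of `n` days, only horizons `h ≤ n` are ever used. -/
abbrev RentalMechanism : Type := (h : ℕ) → History → StagewiseAuction h

/-- Every auction offered by the mechanism is fixed-rate. -/
def RentalMechanism.IsFixedRate (M : RentalMechanism) : Prop :=
  ∀ (h : ℕ) (H : History), (M h H).IsFixedRate

/-- A description of what every agent does in the mechanism `M`, as a function of the horizon and
history at their arrival, and of their valuation. -/
abbrev RentalMechanism.Strategy (M : RentalMechanism) : Type :=
  (h : ℕ) → (H : History) → ℝ → Option (M h H).bids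

/-- Every agent with a valuation in the domain `V` always chooses optimally. -/
def RentalMechanism.Strategy.IsOptimal {M : RentalMechanism} (σ : M.Strategy) (V : Set ℝ) :
    Prop :=
  ∀ (h : ℕ) (H : History), ∀ v ∈ V, (M h H).IsOptimalBid v (σ h H v)

/-- The designer's total reward from the last `h` days, if the asset is available at the beginning
of these days and the history is `H`. The coordinate `v i` is the valuation of the agent
who arrives when `i + 1` days remain, so the current agent has valuation `v (Fin.last _)`. The
designer collects `g(v, p)` for each day rented at price `p` to an agent of valuation `v`; after an
allocation of `x` days the asset is next available when `max x 1` days have passed, and the agents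
who arrive in between are turned away. -/
noncomputable def RentalMechanism.rewardFrom (g : ℝ → ℝ → ℝ) (M : RentalMechanism)
    (σ : M.Strategy) : (h : ℕ) → History → (Fin h → ℝ) → ℝ
  | 0, _, _ => 0
  | k + 1, H, v =>
    let b := σ (k + 1) H (v (Fin.last k))
    let s := (M (k + 1) H).outcome b
    (s.map (fun p : ℝ≥0 => g (v (Fin.last k)) p)).sum +
      M.rewardFrom g σ (k + 1 - max s.length 1)
        (H ++ [b.map (fun c => (c : ℝ≥0))])
        (fun i => v (Fin.castLE (Nat.sub_le _ _) i))
  termination_by h => h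
  decreasing_by omega

/-- The designer's total reward in the rental game of `n` days. -/
noncomputable def RentalMechanism.totalReward (g : ℝ → ℝ → ℝ) (M : RentalMechanism)
    (σ : M.Strategy) (n : ℕ) (v : Fin n → ℝ) : ℝ :=
  M.rewardFrom g σ n [] v

/-- The expected rewards that rental mechanisms satisfying `P` achieve in the rental game of `n`
days whose agents have i.i.d. valuations with law `D`, supported on the domain `V`.
An agent's ties are broken in favor of the designer: all optimal strategies of the agents are
admitted, so that a largest element of this set is the value of an optimal mechanism under
designer-favorable ties. The total reward has to be integrable for its expectation to exist. -/
def achievableRewards (P : RentalMechanism → Prop) (V : Set ℝ) (D : Measure ℝ)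
    (g : ℝ → ℝ → ℝ) (n : ℕ) : Set ℝ :=
  {r | ∃ (M : RentalMechanism) (σ : M.Strategy), P M ∧ σ.IsOptimal V ∧
    Integrable (M.totalReward g σ n) (Measure.pi (fun _ : Fin n => D)) ∧
    r = ∫ v, M.totalReward g σ n v ∂(Measure.pi (fun _ : Fin n => D))}

/-- The reward function consumer surplus. -/
def consumerSurplus (v p : ℝ) : ℝ := v - p

/-- The uniform distribution on `[0,1]`. -/
noncomputable def uniform01 : Measure ℝ := volume.restrict (Set.Icc (0 : ℝ) 1)

/-- Expected rewards of arbitrary rental mechanisms, for consumer surplus and i.i.d. uniform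
valuations on `[0,1]`. -/
def rentalRewards (n : ℕ) : Set ℝ :=
  achievableRewards (fun _ => True) (Set.Icc 0 1) uniform01 consumerSurplus n

/-- Expected rewards of fixed-rate rental mechanisms, for consumer surplus and i.i.d. uniform
valuations on `[0,1]`. -/
def fixedRateRentalRewards (n : ℕ) : Set ℝ :=
  achievableRewards RentalMechanism.IsFixedRate (Set.Icc 0 1) uniform01 consumerSurplus n

open scoped ENNReal

/-! For consumer surplus the designer's reward from a rental is exactly the agent's overall utility.
The game thus reduces to one-stage bounds by dynamic programming: if no auction with `h` days left
yields more than `B h` in expected utility plus continuation value, no mechanism beats `B`, and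
measurable stage choices attaining `B` attain it in the game (`lintegral_rewardFrom_le`,
`mem_achievableRewards_of_schedule`).

Fixed rate: stagewise rationality is then no constraint, so the utility `u` is convex with the
allocated length `x` as subgradient, and `u 0 = 0`. Convexity gives `u v ≤ v * u 1`, so the mean of
`u` is at most `u 1 / 2 ≤ (∫ x) / 2`: every rented day is worth at most 1/2 on average. Giving the
asset away attains this.

General auctions: offer all remaining days for a single payment `t` on the first day. Agents below
`t` cannot afford that day and leave, although `t` is negligible over a long rental. With `t` near 1
the asset waits a bounded expected time for an agent of valuation at least `t`, so the value is at
least `t * n - t / (1 - t)`; it is at most `n`.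

An optimal general auction exists by compactness. Acceptable schedules form a compact space, and
menus of a maximizing sequence converge along a subsequence in Kuratowski's sense. At all but
countably many valuations, limits of optimal choices are optimal in the limit menu
(`limsup_stageValue_le`), and the reverse Fatou lemma finishes. Strategies need not be measurable,
so upper bounds are carried out with lower integrals. -/

instance isProbabilityMeasure_uniform01 : IsProbabilityMeasure uniform01 := by
  constructor
  simp [uniform01]

/-! ### Lower integrals over finite products -/

section Product

variable (D : Measure ℝ) [IsProbabilityMeasure D]

theorem lintegral_pi_succ_eq {k : ℕ} {f : (Fin (k + 1) → ℝ) → ℝ≥0∞} (hf : Measurable f) :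
    ∫⁻ v, f v ∂(Measure.pi fun _ => D) =
      ∫⁻ a, ∫⁻ r, f ((Fin.last k).insertNth a r) ∂(Measure.pi fun _ => D) ∂D := by
  have hp := (measurePreserving_piFinSuccAbove (fun _ : Fin (k + 1) => D) (Fin.last k)).symm
  rw [← hp.lintegral_comp hf]
  exact lintegral_prod _ (hf.comp hp.measurable).aemeasurable

/-- For a function that need not be measurable, the integral over a product is at most the
iterated one. -/
theorem lintegral_pi_succ_le {k : ℕ} (f : (Fin (k + 1) → ℝ) → ℝ≥0∞) :
    ∫⁻ v, f v ∂(Measure.pi fun _ => D) ≤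
      ∫⁻ a, ∫⁻ r, f ((Fin.last k).insertNth a r) ∂(Measure.pi fun _ => D) ∂D := by
  -- The lower integral is attained by a measurable minorant, to which Tonelli applies.
  obtain ⟨g, hg, hgf, he⟩ := exists_measurable_le_lintegral_eq (Measure.pi fun _ => D) f
  rw [he, lintegral_pi_succ_eq D hg]
  exact lintegral_mono fun a => lintegral_mono fun r => hgf _

theorem measurePreserving_castLE {j k : ℕ} (hjk : j ≤ k) :
    MeasurePreserving (fun (v : Fin k → ℝ) i => v (Fin.castLE hjk i))
      (Measure.pi fun _ => D) (Measure.pi fun _ => D) := by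
  induction k, hjk using Nat.le_induction with
  | base => exact MeasurePreserving.id _
  | succ k hjk ih =>
    have hp := measurePreserving_piFinSuccAbove (fun _ : Fin (k + 1) => D) (Fin.last k)
    convert ih.comp (measurePreserving_snd.comp hp) using 1
    funext v i
    simp [MeasurableEquiv.piFinSuccAbove, Fin.insertNthEquiv, Fin.init]

/-- Replaces `measurePreserving_castLE` for continuations of arbitrary strategies: without
measurability of `f`, only this direction is obtained from the iterated lower integrals. -/
theorem lintegral_castLE_le {j k : ℕ} (hjk : j ≤ k) (f : (Fin j → ℝ) → ℝ≥0∞) :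
    ∫⁻ v : Fin k → ℝ, f (fun i => v (Fin.castLE hjk i)) ∂(Measure.pi fun _ => D) ≤
      ∫⁻ v, f v ∂(Measure.pi fun _ => D) := by
  induction k, hjk using Nat.le_induction with
  | base => exact le_rfl
  | succ k hjk ih =>
    refine (lintegral_pi_succ_le D _).trans ?_
    have key : ∀ (a : ℝ) (r : Fin k → ℝ) (i : Fin j),
        (Fin.last k).insertNth (α := fun _ => ℝ) a r (Fin.castLE (hjk.trans (Nat.le_succ k)) i) =
          r (Fin.castLE hjk i) := by
      intro a r i
      have : Fin.castLE (hjk.trans (Nat.le_succ k)) i = (Fin.last k).succAbove (Fin.castLE hjk i) := by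
        simp
      rw [this, Fin.insertNth_apply_succAbove]
    calc _ ≤ ∫⁻ _, ∫⁻ v, f v ∂(Measure.pi fun _ => D) ∂D := by
          refine lintegral_mono fun a => ?_
          simp only [key]
          exact ih
      _ = _ := by simp

end Product

/-! ### Rewards as agents' utilities -/

/-- The interests of designer and agent coincide within one rental; they differ only in the value of
the days left over. -/
theorem sum_map_consumerSurplus (s : List ℝ≥0) (v : ℝ) :
    (s.map (fun p : ℝ≥0 => consumerSurplus v p)).sum = overallUtility s v := by
  simp only [overallUtility, cumulativeUtility, List.take_length, consumerSurplus]
  induction s with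
  | nil => simp
  | cons a s ih =>
    simp only [List.map_cons, List.sum_cons, ih, List.length_cons]
    push_cast
    ring

/-- The value of letting an agent with valuation `v` end up with the schedule `s`, when `h` days
remain and `B j` is the value of having the asset available with `j` days remaining. -/
noncomputable def stageValue (B : ℕ → ℝ≥0∞) (h : ℕ) (s : List ℝ≥0) (v : ℝ) : ℝ≥0∞ :=
  ENNReal.ofReal (overallUtility s v) + B (h - max s.length 1)

theorem rewardFrom_insertNth (M : RentalMechanism) (σ : M.Strategy) (k : ℕ) (H : History)
    (a : ℝ) (r : Fin k → ℝ) :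
    M.rewardFrom consumerSurplus σ (k + 1) H ((Fin.last k).insertNth a r) =
      overallUtility ((M (k + 1) H).outcome (σ (k + 1) H a)) a +
        M.rewardFrom consumerSurplus σ
          (k + 1 - max ((M (k + 1) H).outcome (σ (k + 1) H a)).length 1)
          (H ++ [(σ (k + 1) H a).map (fun c => (c : ℝ≥0))])
          (fun i => r (Fin.castLE (by omega) i)) := by
  have ha : (Fin.last k).insertNth (α := fun _ => ℝ) a r (Fin.last k) = a := by simp
  have hr : r = fun i => (Fin.last k).insertNth (α := fun _ => ℝ) a r i.castSucc := by simp
  generalize (Fin.last k).insertNth (α := fun _ => ℝ) a r = v at ha hr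
  subst ha hr
  rw [RentalMechanism.rewardFrom]
  simp only [sum_map_consumerSurplus]
  rfl

/-- If no stage improves on the values `B`, then neither does the whole game. -/
theorem lintegral_rewardFrom_le (B : ℕ → ℝ≥0∞) (M : RentalMechanism) (σ : M.Strategy)
    (hB : ∀ h H, 1 ≤ h →
      ∫⁻ v, stageValue B h ((M h H).outcome (σ h H v)) v ∂uniform01 ≤ B h) (h : ℕ) (H : History) :
    ∫⁻ v, ENNReal.ofReal (M.rewardFrom consumerSurplus σ h H v)
      ∂(Measure.pi fun _ => uniform01) ≤ B h := by
  induction h using Nat.strong_induction_on generalizing H with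
  | _ h ih =>
    cases h with
    | zero => simp [RentalMechanism.rewardFrom]
    | succ k =>
      refine (lintegral_pi_succ_le uniform01 _).trans (le_trans ?_ (hB (k + 1) H (by omega)))
      refine lintegral_mono fun a => ?_
      simp only [rewardFrom_insertNth]
      refine (lintegral_mono fun r => ENNReal.ofReal_add_le).trans ?_
      -- With `a` fixed, the current agent's utility is constant, so additivity holds even for a
      -- nonmeasurable continuation.
      rw [lintegral_add_left measurable_const]
      refine add_le_add (by simp) ?_
      exact (lintegral_castLE_le uniform01 _
        (fun r => ENNReal.ofReal (M.rewardFrom consumerSurplus σ _ _ r))).trans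
        (ih _ (by omega) _)

/-! ### Mechanisms that ignore the history -/

/-- The total reward, when an agent with valuation `v` who arrives with `h` days remaining ends up
with the schedule `s h v`. -/
noncomputable def scheduleReward (s : ℕ → ℝ → List ℝ≥0) : (h : ℕ) → (Fin h → ℝ) → ℝ
  | 0, _ => 0
  | k + 1, v =>
    overallUtility (s (k + 1) (v (Fin.last k))) (v (Fin.last k)) +
      scheduleReward s (k + 1 - max (s (k + 1) (v (Fin.last k))).length 1)
        (fun i => v (Fin.castLE (Nat.sub_le _ _) i))
  termination_by h => h
  decreasing_by omega

theorem rewardFrom_eq_scheduleReward (A : (h : ℕ) → StagewiseAuction h)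
    (τ : (h : ℕ) → ℝ → Option (A h).bids) (h : ℕ) (H : History) (v : Fin h → ℝ) :
    RentalMechanism.rewardFrom consumerSurplus (fun h _ => A h) (fun h _ => τ h) h H v =
      scheduleReward (fun h v => (A h).outcome (τ h v)) h v := by
  induction h using Nat.strong_induction_on generalizing H with
  | _ h ih =>
    cases h with
    | zero => simp [RentalMechanism.rewardFrom, scheduleReward]
    | succ k =>
      rw [RentalMechanism.rewardFrom, scheduleReward]
      simp only [sum_map_consumerSurplus]
      rw [ih _ (by omega)]

theorem measurable_scheduleReward (s : ℕ → ℝ → List ℝ≥0)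
    (hu : ∀ h, Measurable fun v => overallUtility (s h v) v)
    (hl : ∀ h, Measurable fun v => (s h v).length) (h : ℕ) : Measurable (scheduleReward s h) := by
  induction h using Nat.strong_induction_on with
  | _ h ih =>
    cases h with
    | zero => 
      have : scheduleReward s 0 = fun _ => 0 := by funext v; rw [scheduleReward]
      exact this ▸ measurable_const
    | succ k =>
      -- The horizon of the continuation depends on the valuation, but only through a natural
      -- number, so measurability can be checked for each length separately.
      have hG : Measurable fun q : ℕ × (Fin (k + 1) → ℝ) =>
          scheduleReward s (k + 1 - max q.1 1) (fun i => q.2 (Fin.castLE (Nat.sub_le _ _) i)) := by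
        refine measurable_from_prod_countable_right fun j => ?_
        exact (ih (k + 1 - max j 1) (by omega)).comp
          (measurable_pi_lambda (fun (v : Fin (k + 1) → ℝ) i => v (Fin.castLE (Nat.sub_le _ _) i))
            fun i => measurable_pi_apply _)
      have h1 : Measurable fun v : Fin (k + 1) → ℝ => v (Fin.last k) := measurable_pi_apply _
      have := ((hu (k + 1)).comp h1).add
        (hG.comp (((hl (k + 1)).comp h1).prodMk measurable_id))
      convert this using 1
      funext v
      rw [scheduleReward]
      rfl

theorem scheduleReward_nonneg (s : ℕ → ℝ → List ℝ≥0) (hu : ∀ h v, 0 ≤ overallUtility (s h v) v)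
    (h : ℕ) (v : Fin h → ℝ) : 0 ≤ scheduleReward s h v := by
  induction h using Nat.strong_induction_on with
  | _ h ih =>
    cases h with
    | zero => simp [scheduleReward]
    | succ k =>
      rw [scheduleReward]
      exact add_nonneg (hu _ _) (ih _ (by omega) _)

/-- Measurability and nonnegativity turn every inequality in the proof of `lintegral_rewardFrom_le`
into an equality. -/
theorem lintegral_scheduleReward (B : ℕ → ℝ≥0∞) (s : ℕ → ℝ → List ℝ≥0)
    (hu : ∀ h, Measurable fun v => overallUtility (s h v) v)
    (hl : ∀ h, Measurable fun v => (s h v).length)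
    (hn : ∀ h v, 0 ≤ overallUtility (s h v) v)
    (h0 : B 0 = 0) (hB : ∀ h, 1 ≤ h → ∫⁻ v, stageValue B h (s h v) v ∂uniform01 = B h) (h : ℕ) :
    ∫⁻ v, ENNReal.ofReal (scheduleReward s h v) ∂(Measure.pi fun _ => uniform01) = B h := by
  induction h using Nat.strong_induction_on with
  | _ h ih =>
    cases h with
    | zero => simp [scheduleReward, h0]
    | succ k =>
      rw [lintegral_pi_succ_eq uniform01 (measurable_scheduleReward s hu hl _).ennreal_ofReal,
        ← hB (k + 1) (by omega)]
      refine lintegral_congr fun a => ?_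
      have key : ∀ r : Fin k → ℝ, scheduleReward s (k + 1) ((Fin.last k).insertNth a r) =
          overallUtility (s (k + 1) a) a +
            scheduleReward s (k + 1 - max (s (k + 1) a).length 1)
              (fun i => r (Fin.castLE (by omega) i)) := by
        intro r
        have ha : (Fin.last k).insertNth (α := fun _ => ℝ) a r (Fin.last k) = a := by simp
        have hr : r = fun i => (Fin.last k).insertNth (α := fun _ => ℝ) a r i.castSucc := by simp
        generalize (Fin.last k).insertNth (α := fun _ => ℝ) a r = v at ha hr
        subst ha hr
        rw [scheduleReward]
        rfl
      simp only [key]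
      rw [lintegral_congr fun r => ENNReal.ofReal_add (hn _ _) (scheduleReward_nonneg s hn _ _),
        lintegral_add_left measurable_const, stageValue]
      congr 1
      · simp
      · rw [← ih (k + 1 - max (s (k + 1) a).length 1) (by omega)]
        exact (measurePreserving_castLE uniform01 _).lintegral_comp
          (measurable_scheduleReward s hu hl _).ennreal_ofReal

/-- If the stages of a mechanism that ignores the history attain the finite values `B`, then the
mechanism attains the value `B n` in the game of `n` days. -/
theorem mem_achievableRewards_of_schedule {P : RentalMechanism → Prop} (B : ℕ → ℝ≥0∞)
    (A : (h : ℕ) → StagewiseAuction h) (τ : (h : ℕ) → ℝ → Option (A h).bids)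
    (hP : P fun h _ => A h) (hτ : ∀ h, ∀ v ∈ Set.Icc (0 : ℝ) 1, (A h).IsOptimalBid v (τ h v))
    (hu : ∀ h, Measurable fun v => overallUtility ((A h).outcome (τ h v)) v)
    (hl : ∀ h, Measurable fun v => ((A h).outcome (τ h v)).length)
    (hn : ∀ h v, 0 ≤ overallUtility ((A h).outcome (τ h v)) v)
    (h0 : B 0 = 0)
    (hB : ∀ h, 1 ≤ h →
      ∫⁻ v, stageValue B h ((A h).outcome (τ h v)) v ∂uniform01 = B h)
    (n : ℕ) (hfin : B n ≠ ∞) :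
    (B n).toReal ∈ achievableRewards P (Set.Icc 0 1) uniform01 consumerSurplus n := by
  have hm := measurable_scheduleReward (fun h v => (A h).outcome (τ h v)) hu hl n
  have hI := lintegral_scheduleReward B (fun h v => (A h).outcome (τ h v)) hu hl hn h0 hB n
  have hnn := scheduleReward_nonneg (fun h v => (A h).outcome (τ h v)) hn n
  have he : RentalMechanism.totalReward consumerSurplus (fun h _ => A h)
      (fun h _ => τ h) n = scheduleReward (fun h v => (A h).outcome (τ h v)) n := by
    funext v
    exact rewardFrom_eq_scheduleReward A τ n [] v
  refine ⟨fun h _ => A h, fun h _ => τ h, hP, fun h _ => hτ h, ?_, ?_⟩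
  · rw [he]
    refine ⟨hm.aestronglyMeasurable, ?_⟩
    rw [hasFiniteIntegral_iff_ofReal (Eventually.of_forall hnn), hI]
    exact hfin.lt_top
  · rw [he, integral_eq_lintegral_of_nonneg_ae (Eventually.of_forall hnn)
      hm.aestronglyMeasurable, hI]

/-- The expectation is at most that of the positive part, which is what the lower-integral bound
controls. -/
theorem le_of_mem_achievableRewards {P : RentalMechanism → Prop} (B : ℕ → ℝ≥0∞)
    (hB : ∀ (M : RentalMechanism) (σ : M.Strategy), P M → σ.IsOptimal (Set.Icc 0 1) →
      ∀ h H, 1 ≤ h → ∫⁻ v, stageValue B h ((M h H).outcome (σ h H v)) v ∂uniform01 ≤ B h)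
    (n : ℕ) (hfin : B n ≠ ∞) {r : ℝ}
    (hr : r ∈ achievableRewards P (Set.Icc 0 1) uniform01 consumerSurplus n) :
    r ≤ (B n).toReal := by
  obtain ⟨M, σ, hP, hσ, hint, rfl⟩ := hr
  have h1 := lintegral_rewardFrom_le B M σ (hB M σ hP hσ) n []
  calc ∫ v, M.totalReward consumerSurplus σ n v ∂(Measure.pi fun _ => uniform01)
      ≤ (∫⁻ v, ENNReal.ofReal (M.totalReward consumerSurplus σ n v)
          ∂(Measure.pi fun _ => uniform01)).toReal := by
        rw [integral_eq_lintegral_pos_part_sub_lintegral_neg_part hint]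
        exact sub_le_self _ ENNReal.toReal_nonneg
    _ ≤ (B n).toReal := ENNReal.toReal_mono hfin h1

/-! ### Fixed-rate auctions -/

theorem overallUtility_eq (s : List ℝ≥0) (v : ℝ) :
    overallUtility s v = s.length * v - ((s.sum : ℝ≥0) : ℝ) := by
  simp [overallUtility, cumulativeUtility, NNReal.coe_list_sum]

theorem overallUtility_nonneg_of_stagewiseIR {s : List ℝ≥0} {v : ℝ} (h : StagewiseIR s v) :
    0 ≤ overallUtility s v := by
  rcases Nat.eq_zero_or_pos s.length with h0 | h0
  · simp [List.length_eq_zero_iff.1 h0, overallUtility, cumulativeUtility]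
  · exact h _ h0 le_rfl

theorem stagewiseIR_nil (v : ℝ) : StagewiseIR [] v := fun i h1 h2 => by
  simp at h2; omega

theorem overallUtility_nil (v : ℝ) : overallUtility [] v = 0 := by
  simp [overallUtility, cumulativeUtility]

theorem StagewiseAuction.IsOptimalBid.overallUtility_nonneg {n : ℕ} {A : StagewiseAuction n}
    {v : ℝ} {b : Option A.bids} (h : A.IsOptimalBid v b) :
    0 ≤ overallUtility (A.outcome b) v :=
  overallUtility_nonneg_of_stagewiseIR h.1

theorem StagewiseAuction.length_outcome_le {n : ℕ} (A : StagewiseAuction n)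
    (b : Option A.bids) : (A.outcome b).length ≤ n := by
  cases b with
  | none => simp [outcome]
  | some b => exact A.length_le b

theorem cumulativeUtility_replicate (m : ℕ) (p : ℝ≥0) (v : ℝ) {i : ℕ} (hi : i ≤ m) :
    cumulativeUtility (List.replicate m p) v i = i * (v - p) := by
  simp [cumulativeUtility, List.take_replicate, hi]
  ring

/-- In a fixed-rate auction, stagewise individual rationality does not restrict deviations. -/
theorem StagewiseAuction.IsFixedRate.overallUtility_le {n : ℕ} {A : StagewiseAuction n}
    (hA : A.IsFixedRate) {v : ℝ} {b : Option A.bids} (hb : A.IsOptimalBid v b)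
    (b' : Option A.bids) : overallUtility (A.outcome b') v ≤ overallUtility (A.outcome b) v := by
  cases b' with
  | none => simpa [outcome, overallUtility_nil] using hb.overallUtility_nonneg
  | some c =>
    obtain ⟨p, hp⟩ := hA c
    change overallUtility (A.schedule c) v ≤ _
    -- If `p ≤ v`, every prefix is acceptable; if `p > v`, the bid is no better than making none.
    rcases le_or_gt (p : ℝ) v with h | h
    · refine hb.2 (some c) ?_
      change StagewiseIR (A.schedule c) v
      rw [hp]
      intro i _ hi
      rw [List.length_replicate] at hi
      rw [cumulativeUtility_replicate _ _ _ hi]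
      exact mul_nonneg (Nat.cast_nonneg _) (by linarith)
    · refine le_trans ?_ hb.overallUtility_nonneg
      rw [hp, overallUtility, List.length_replicate, cumulativeUtility_replicate _ _ _ le_rfl]
      exact mul_nonpos_of_nonneg_of_nonpos (Nat.cast_nonneg _) (by linarith)

/-- If `x` is a bounded selection of subgradients of `u` on `[0,1]`, then `u 1 - u 0` is at most
the integral of `x`. -/
theorem sub_le_integral_of_subgradient {u x : ℝ → ℝ} {C : ℝ}
    (hsub : ∀ v ∈ Set.Icc (0 : ℝ) 1, ∀ w ∈ Set.Icc (0 : ℝ) 1, u v + x v * (w - v) ≤ u w)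
    (hx : ∀ v, 0 ≤ x v ∧ x v ≤ C) : u 1 - u 0 ≤ ∫ v in (0 : ℝ)..1, x v := by
  have hmono : MonotoneOn x (Set.Icc 0 1) := by
    intro v hv w hw hvw
    rcases hvw.eq_or_lt with rfl | hlt
    · rfl
    have h1 := hsub v hv w hw
    have h2 := hsub w hw v hv
    by_contra! hc
    nlinarith
  -- On a grid of mesh `1 / N`, the increments of `u` are bounded by `x` at right endpoints. As `x`
  -- is monotone, the right Riemann sum exceeds the left one, hence the integral, by at most `(x 1 -
  -- x 0) / N ≤ C / N`.
  have key : ∀ N : ℕ, 0 < N → u 1 - u 0 ≤ (∫ v in (0 : ℝ)..1, x v) + C / N := by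
    intro N hN
    have hN' : (0 : ℝ) < N := by exact_mod_cast hN
    have hmem : ∀ i : ℕ, i ≤ N → (i : ℝ) / N ∈ Set.Icc (0 : ℝ) 1 := fun i hi =>
      ⟨by positivity, (div_le_one hN').2 (by exact_mod_cast hi)⟩
    have h1 := MonotoneOn.sum_le_integral (f := fun y => x (y / N)) (x₀ := 0) (a := N) (by
      intro a ha b hb hab
      simp only [zero_add] at ha hb
      exact hmono ⟨by have := ha.1; positivity, (div_le_one hN').2 ha.2⟩
        ⟨by have := hb.1; positivity, (div_le_one hN').2 hb.2⟩ (by gcongr))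
    simp only [zero_add] at h1
    rw [intervalIntegral.integral_comp_div _ hN'.ne', zero_div, div_self hN'.ne', smul_eq_mul] at h1
    have h2 : u 1 - u 0 ≤ ∑ i ∈ Finset.range N, x ((i + 1 : ℕ) / N) / N := by
      have ht := Finset.sum_range_sub (fun i : ℕ => u (i / N)) N
      simp only [div_self hN'.ne', Nat.cast_zero, zero_div] at ht
      rw [← ht]
      refine Finset.sum_le_sum fun i hi => ?_
      have hi := Finset.mem_range.1 hi
      have := hsub _ (hmem (i + 1) hi) _ (hmem i hi.le)
      have e : (i : ℝ) / N - ((i + 1 : ℕ) : ℝ) / N = -(1 / N) := by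
        push_cast; field_simp; ring
      rw [e] at this
      have e2 : x (((i + 1 : ℕ) : ℝ) / N) / N = x (((i + 1 : ℕ) : ℝ) / N) * (1 / N) := by ring
      linarith
    have h3 := Finset.sum_range_succ' (fun i : ℕ => x (i / N)) N
    rw [Finset.sum_range_succ] at h3
    rw [← Finset.sum_div, le_div_iff₀ hN'] at h2
    have h4 := (hx ((N : ℝ) / N)).2
    have h5 := (hx (((0 : ℕ) : ℝ) / N)).1
    have h6 : (u 1 - u 0) * N ≤ ((∫ v in (0 : ℝ)..1, x v) + C / N) * N := by
      rw [add_mul, div_mul_cancel₀ _ hN'.ne']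
      linarith
    exact le_of_mul_le_mul_right h6 hN'
  have hlim : Tendsto (fun N : ℕ => (∫ v in (0 : ℝ)..1, x v) + C / N) atTop
      (𝓝 ((∫ v in (0 : ℝ)..1, x v) + 0)) :=
    tendsto_const_nhds.add (tendsto_const_div_atTop_nhds_zero_nat C)
  rw [add_zero] at hlim
  exact ge_of_tendsto hlim ((eventually_gt_atTop 0).mono key)

theorem integral_uniform01 (f : ℝ → ℝ) : ∫ v, f v ∂uniform01 = ∫ v in (0 : ℝ)..1, f v := by
  rw [intervalIntegral.integral_of_le zero_le_one, uniform01, integral_Icc_eq_integral_Ioc]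

theorem ae_mem_Icc_uniform01 : ∀ᵐ v ∂uniform01, v ∈ Set.Icc (0 : ℝ) 1 :=
  ae_restrict_mem measurableSet_Icc

/-- A fixed-rate auction cannot improve on an average surplus of `1/2` a day. -/
theorem lintegral_stageValue_le_of_isFixedRate {h : ℕ} (h1 : 1 ≤ h) {A : StagewiseAuction h}
    (hA : A.IsFixedRate) {τ : ℝ → Option A.bids}
    (hτ : ∀ v ∈ Set.Icc (0 : ℝ) 1, A.IsOptimalBid v (τ v)) :
    ∫⁻ v, stageValue (fun j => ENNReal.ofReal (j / 2)) h (A.outcome (τ v)) v ∂uniform01 ≤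
      ENNReal.ofReal (h / 2) := by
  set u : ℝ → ℝ := fun v => overallUtility (A.outcome (τ v)) v with hu
  set x : ℝ → ℝ := fun v => (A.outcome (τ v)).length with hx
  -- Type `w` may imitate type `v`, which makes `x v` a subgradient of `u` at `v`.
  have hsub : ∀ v ∈ Set.Icc (0 : ℝ) 1, ∀ w ∈ Set.Icc (0 : ℝ) 1, u v + x v * (w - v) ≤ u w := by
    intro v _ w hw
    refine le_trans (le_of_eq ?_) (hA.overallUtility_le (hτ w hw) (τ v))
    simp only [hu, hx, overallUtility_eq]
    ring
  have hxb : ∀ v, 0 ≤ x v ∧ x v ≤ h := fun v =>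
    ⟨Nat.cast_nonneg _, Nat.cast_le.2 (A.length_outcome_le _)⟩
  have hu0 : u 0 = 0 := by
    refine le_antisymm ?_ (hτ 0 (by simp)).overallUtility_nonneg
    simp [hu, overallUtility_eq]
  have hmono : MonotoneOn x (Set.Icc 0 1) := by
    intro v hv w hw hvw
    rcases hvw.eq_or_lt with rfl | hlt
    · rfl
    have h1 := hsub v hv w hw
    have h2 := hsub w hw v hv
    by_contra! hc
    nlinarith
  have hux := sub_le_integral_of_subgradient hsub hxb
  have hxi : Integrable x uniform01 := hmono.integrableOn_isCompact isCompact_Icc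
  have hli : Integrable (fun v : ℝ => v * u 1) uniform01 :=
    (Continuous.integrableOn_Icc (by fun_prop))
  -- The utility lies below its chord from `u 0 = 0` to `u 1`. The chord has mean `u 1 / 2`, which
  -- the term `-x v / 2` offsets after integration.
  have hbound : ∀ᵐ v ∂uniform01,
      stageValue (fun j => ENNReal.ofReal (j / 2)) h (A.outcome (τ v)) v ≤
        ENNReal.ofReal (v * u 1 + (h - x v) / 2) := by
    filter_upwards [ae_mem_Icc_uniform01] with v hv
    have hv0 : 0 ≤ v * u 1 := mul_nonneg hv.1 (hτ 1 (by simp)).overallUtility_nonneg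
    rw [stageValue, ENNReal.ofReal_add hv0 (by linarith [(hxb v).2])]
    refine add_le_add (ENNReal.ofReal_le_ofReal ?_) (ENNReal.ofReal_le_ofReal ?_)
    · have e0 := hsub v hv 0 (by simp)
      have e1 := hsub v hv 1 (by simp)
      rw [hu0] at e0
      have := mul_le_mul_of_nonneg_left e1 hv.1
      have := mul_le_mul_of_nonneg_left e0 (sub_nonneg.2 hv.2)
      change u v ≤ _
      linarith
    · have hle : (A.outcome (τ v)).length ≤ max (A.outcome (τ v)).length 1 := le_max_left _ _
      have hm : max (A.outcome (τ v)).length 1 ≤ h := max_le (A.length_outcome_le _) h1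
      rw [Nat.cast_sub hm]
      have : x v ≤ ((max (A.outcome (τ v)).length 1 : ℕ) : ℝ) := Nat.cast_le.2 hle
      linarith
  refine (lintegral_mono_ae hbound).trans ?_
  rw [← ofReal_integral_eq_lintegral_ofReal]
  · refine ENNReal.ofReal_le_ofReal ?_
    have hxi2 : Integrable (fun v => (h - x v) / 2) uniform01 :=
      ((integrable_const _).sub hxi).div_const 2
    rw [integral_add hli hxi2, integral_div, integral_sub (integrable_const _) hxi,
      integral_uniform01 x, integral_uniform01]
    simp only [intervalIntegral.integral_mul_const, integral_id, integral_const, probReal_univ,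
      smul_eq_mul]
    rw [hu0] at hux
    linarith
  · exact hli.add (((integrable_const _).sub hxi).div_const 2)
  · filter_upwards [ae_mem_Icc_uniform01] with v hv
    have hv0 : 0 ≤ v * u 1 := mul_nonneg hv.1 (hτ 1 (by simp)).overallUtility_nonneg
    have := (hxb v).2
    change 0 ≤ _
    linarith

/-- The auction that gives away all units for free. -/
def freeAuction (h : ℕ) : StagewiseAuction h where
  bids := {0}
  schedule _ := List.replicate h 0
  length_le _ := by simp

/-- Agents with nonnegative valuations take all units that are given away. -/
noncomputable def freeStrategy (h : ℕ) (v : ℝ) : Option (freeAuction h).bids :=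
  if 0 ≤ v then some ⟨0, Set.mem_singleton 0⟩ else none

theorem freeAuction_outcome (h : ℕ) (v : ℝ) :
    (freeAuction h).outcome (freeStrategy h v) = if 0 ≤ v then List.replicate h 0 else [] := by
  unfold freeStrategy
  split_ifs <;> rfl

theorem isGreatest_fixedRateRentalRewards (n : ℕ) :
    IsGreatest (fixedRateRentalRewards n) (n / 2) := by
  have e : ((n : ℝ) / 2) = (ENNReal.ofReal ((n : ℝ) / 2)).toReal :=
    (ENNReal.toReal_ofReal (by positivity)).symm
  constructor
  · rw [e]
    have hu : ∀ h : ℕ, ∀ v : ℝ, overallUtility (List.replicate h (0 : ℝ≥0)) v = h * v := by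
      intro h v
      simp [overallUtility_eq]
    refine mem_achievableRewards_of_schedule (fun j => ENNReal.ofReal (j / 2)) freeAuction
      freeStrategy ?_ ?_ ?_ ?_ ?_ ?_ ?_ n ENNReal.ofReal_ne_top
    · intro h _ b
      exact ⟨0, by simp [freeAuction]⟩
    · intro h v hv
      have hnn : 0 ≤ (h : ℝ) * v := mul_nonneg (Nat.cast_nonneg _) hv.1
      refine ⟨?_, ?_⟩
      · rw [freeAuction_outcome, if_pos hv.1]
        intro i _ hi
        rw [List.length_replicate] at hi
        rw [cumulativeUtility_replicate _ _ _ hi]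
        exact mul_nonneg (Nat.cast_nonneg _) (by simpa using hv.1)
      · rintro (_ | b) _
        · rw [freeAuction_outcome, if_pos hv.1, hu]
          simpa [StagewiseAuction.outcome, overallUtility_nil] using hnn
        · rw [freeAuction_outcome, if_pos hv.1]
          exact le_rfl
    · intro h
      have : (fun v : ℝ => overallUtility ((freeAuction h).outcome (freeStrategy h v)) v) =
          fun v : ℝ => if 0 ≤ v then h * v else 0 := by
        funext v
        rw [freeAuction_outcome]
        split_ifs
        · exact hu h v
        · exact overallUtility_nil v
      rw [this]
      exact Measurable.ite measurableSet_Ici (by fun_prop) measurable_const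
    · intro h
      simp only [freeAuction_outcome, apply_ite List.length, List.length_replicate, List.length_nil]
      exact Measurable.ite measurableSet_Ici measurable_const measurable_const
    · intro h v
      rw [freeAuction_outcome]
      split_ifs with hv
      · rw [hu]
        exact mul_nonneg (Nat.cast_nonneg _) hv
      · exact (overallUtility_nil v).ge
    · simp
    · intro h h1
      have : ∀ᵐ v ∂uniform01, stageValue (fun j => ENNReal.ofReal (j / 2)) h
          ((freeAuction h).outcome (freeStrategy h v)) v = ENNReal.ofReal (h * v) := by
        filter_upwards [ae_mem_Icc_uniform01] with v hv
        simp [hv.1, stageValue, freeAuction_outcome, hu, h1]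
      rw [lintegral_congr_ae this, ← ofReal_integral_eq_lintegral_ofReal]
      · rw [integral_uniform01, intervalIntegral.integral_const_mul, integral_id]
        congr 1
        ring
      · exact Continuous.integrableOn_Icc (by fun_prop)
      · filter_upwards [ae_mem_Icc_uniform01] with v hv
        exact mul_nonneg (Nat.cast_nonneg _) hv.1
  · intro r hr
    rw [e]
    exact le_of_mem_achievableRewards (fun j => ENNReal.ofReal (j / 2))
      (fun M σ hM hσ h H h1 => lintegral_stageValue_le_of_isFixedRate h1 (hM h H) (hσ h H)) n
      ENNReal.ofReal_ne_top hr

/-! ### Limits of sequences of sets -/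

section Kuratowski

variable {X : Type*} [TopologicalSpace X]

/-- The upper Kuratowski limit of a sequence of sets. -/
def upperLimit (S : ℕ → Set X) : Set X :=
  {e | ∀ U ∈ 𝓝 e, ∃ᶠ n in atTop, (S n ∩ U).Nonempty}

theorem isClosed_upperLimit (S : ℕ → Set X) : IsClosed (upperLimit S) := by
  refine isClosed_of_closure_subset fun e he U hU => ?_
  obtain ⟨V, hVU, hV, heV⟩ := mem_nhds_iff.1 hU
  obtain ⟨e', he', h⟩ := mem_closure_iff.1 he V hV heV
  exact (h V (hV.mem_nhds he')).mono fun n hn => hn.mono (Set.inter_subset_inter_right _ hVU)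

theorem upperLimit_subset {S : ℕ → Set X} {K : Set X} (hK : IsClosed K) (hS : ∀ n, S n ⊆ K) :
    upperLimit S ⊆ K := by
  intro e he
  by_contra hc
  obtain ⟨n, x, hx, hx'⟩ := (he _ (hK.isOpen_compl.mem_nhds hc)).exists
  exact hx' (hS n hx)

theorem mem_upperLimit_of_tendsto {S : ℕ → Set X} {ψ : ℕ → ℕ} (hψ : StrictMono ψ) {x : ℕ → X}
    (hx : ∀ n, x n ∈ S (ψ n)) {e : X} (h : Tendsto x atTop (𝓝 e)) : e ∈ upperLimit S := by
  intro U hU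
  exact hψ.tendsto_atTop.frequently
    ((h.eventually_mem hU).mono fun n hn => ⟨x n, hx n, hn⟩).frequently

/-- In a second countable space, every sequence of sets has a subsequence that converges in the
sense of Kuratowski. -/
theorem exists_subseq_upperLimit [SecondCountableTopology X] (S : ℕ → Set X) :
    ∃ φ : ℕ → ℕ, StrictMono φ ∧ ∀ e ∈ upperLimit (S ∘ φ), ∀ U ∈ 𝓝 e,
      ∀ᶠ n in atTop, (S (φ n) ∩ U).Nonempty := by
  classical
  obtain ⟨b, hbc, -, hb⟩ := TopologicalSpace.exists_countable_basis X
  have := hbc.to_subtype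
  -- Which basic open sets meet `S n` is a point of a countable product of two-point spaces, and
  -- this product is sequentially compact.
  obtain ⟨a, φ, hφ, ha⟩ := CompactSpace.tendsto_subseq
    (fun n => fun B : b => decide ((S n ∩ B).Nonempty))
  refine ⟨φ, hφ, fun e he U hU => ?_⟩
  obtain ⟨B, hB, heB, hBU⟩ := hb.mem_nhds_iff.1 hU
  have hev : ∀ᶠ n in atTop, decide ((S (φ n) ∩ B).Nonempty) = a ⟨B, hB⟩ :=
    (tendsto_pi_nhds.1 ha ⟨B, hB⟩).eventually_mem ((isOpen_discrete {a ⟨B, hB⟩}).mem_nhds rfl)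
  obtain ⟨n, hn, hn'⟩ := ((he B ((hb.isOpen hB).mem_nhds heB)).and_eventually hev).exists
  filter_upwards [hev] with m hm
  rw [← hn', decide_eq_decide] at hm
  exact (hm.2 hn).mono (Set.inter_subset_inter_right _ hBU)

end Kuratowski

/-! ### Schedules as points of a topological space -/

/-- A schedule of at most `h` payments: its length, and payments of which those within this length
count. -/
abbrev Entry (h : ℕ) : Type := (Fin h → ℝ≥0) × Fin (h + 1)

namespace Entry

variable {h : ℕ}

/-- The payment schedule that an entry describes. -/
def toList (e : Entry h) : List ℝ≥0 := (List.ofFn e.1).take e.2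

theorem length_toList (e : Entry h) : (toList e).length = e.2 := by
  simp [toList, Nat.lt_succ_iff.1 e.2.2]

theorem cumulativeUtility_toList (e : Entry h) (v : ℝ) (i : ℕ) :
    cumulativeUtility (toList e) v i =
      i * v - ∑ j : Fin h, if (j : ℕ) < min i e.2 then (e.1 j : ℝ) else 0 := by
  rw [cumulativeUtility, toList, List.take_take, ← NNReal.coe_list_sum, List.sum_take_ofFn,
    NNReal.coe_sum, Finset.sum_filter]

theorem continuous_cumulativeUtility (v : ℝ) (i : ℕ) :
    Continuous fun e : Entry h => cumulativeUtility (toList e) v i := by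
  simp only [cumulativeUtility_toList]
  refine continuous_const.sub (continuous_finsetSum _ fun j _ => ?_)
  have h1 : Continuous fun x : Fin (h + 1) => if (j : ℕ) < min i x then (1 : ℝ) else 0 :=
    continuous_of_discreteTopology
  have h2 : Continuous fun e : Entry h =>
      (if (j : ℕ) < min i e.2 then (1 : ℝ) else 0) * (e.1 j : ℝ) :=
    (h1.comp continuous_snd).mul (by fun_prop)
  convert h2 using 2 with e
  split_ifs <;> simp

theorem overallUtility_toList (e : Entry h) (v : ℝ) :
    overallUtility (toList e) v = cumulativeUtility (toList e) v e.2 := by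
  rw [overallUtility, length_toList]

theorem cumulativeUtility_sub (s : List ℝ≥0) (v w : ℝ) (i : ℕ) :
    cumulativeUtility s w i - cumulativeUtility s v i = i * (w - v) := by
  simp only [cumulativeUtility]
  ring

theorem overallUtility_mono (s : List ℝ≥0) : Monotone (overallUtility s) := by
  intro v w hvw
  have := cumulativeUtility_sub s v w s.length
  have h2 : 0 ≤ (s.length : ℝ) * (w - v) := mul_nonneg (Nat.cast_nonneg _) (by linarith)
  simp only [overallUtility]
  linarith

theorem stagewiseIR_mono {s : List ℝ≥0} {v w : ℝ} (hvw : v ≤ w) (hs : StagewiseIR s v) :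
    StagewiseIR s w := by
  intro i h1 h2
  have := cumulativeUtility_sub s v w i
  have h3 : 0 ≤ (i : ℝ) * (w - v) := mul_nonneg (Nat.cast_nonneg _) (by linarith)
  have := hs i h1 h2
  linarith

theorem continuous_overallUtility (v : ℝ) :
    Continuous fun e : Entry h => overallUtility (toList e) v := by
  have : (fun e : Entry h => overallUtility (toList e) v) = fun e =>
      e.2 * v - ∑ j : Fin h, if (j : ℕ) < min h e.2 then (e.1 j : ℝ) else 0 := by
    funext e
    rw [overallUtility_toList, cumulativeUtility_toList]
    simp [Nat.lt_succ_iff.1 e.2.2]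
  -- Taking `i = h` counts all payments, since they are cut off at the length anyway; only the
  -- coefficient of `v` needs correcting from `h` to `e.2`.
  have h1 := continuous_cumulativeUtility (h := h) v h
  have h2 : Continuous fun x : Fin (h + 1) => (x : ℝ) * v - h * v := continuous_of_discreteTopology
  rw [this]
  convert h1.add (h2.comp continuous_snd) using 2 with e
  simp only [Pi.add_apply, Function.comp, cumulativeUtility_toList]
  ring

theorem isClosed_stagewiseIR (v : ℝ) : IsClosed {e : Entry h | StagewiseIR (toList e) v} := by
  simp only [StagewiseIR, Set.ofPred_forall, length_toList]
  refine isClosed_iInter fun i => isClosed_iInter fun _ => isClosed_imp ?_ ?_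
  · exact (isOpen_discrete {x : Fin (h + 1) | i ≤ x}).preimage continuous_snd
  · exact isClosed_Ici.preimage (continuous_cumulativeUtility v i)

/-- Acceptability is a closed condition, not an open one; a strictly larger valuation gives every
constraint slack, which survives small perturbations. -/
theorem eventually_stagewiseIR {e : Entry h} {v w : ℝ} (hvw : v < w)
    (he : StagewiseIR (toList e) v) : ∀ᶠ e' in 𝓝 e, StagewiseIR (toList e') w := by
  have h1 : ∀ᶠ e' : Entry h in 𝓝 e, e'.2 = e.2 :=
    continuous_snd.continuousAt.eventually_mem ((isOpen_discrete {e.2}).mem_nhds rfl)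
  have h2 : ∀ᶠ e' : Entry h in 𝓝 e, ∀ i ∈ Finset.Icc 1 (e.2 : ℕ),
      0 < cumulativeUtility (toList e') w i := by
    rw [Filter.eventually_all_finset]
    intro i hi
    rw [Finset.mem_Icc] at hi
    refine (continuous_cumulativeUtility w i).continuousAt.eventually_const_lt ?_
    have h3 := he i hi.1 (by rw [length_toList]; exact hi.2)
    have h4 := cumulativeUtility_sub (toList e) v w i
    have h5 : 0 < (i : ℝ) * (w - v) := mul_pos (by exact_mod_cast hi.1) (by linarith)
    linarith
  filter_upwards [h1, h2] with e' h1 h2 i hi hi'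
  rw [length_toList, h1] at hi'
  exact (h2 i (Finset.mem_Icc.2 ⟨hi, hi'⟩)).le

theorem continuous_stageValue (B : ℕ → ℝ≥0∞) (v : ℝ) :
    Continuous fun e : Entry h => stageValue B h (toList e) v := by
  simp only [stageValue, length_toList]
  have h1 : Continuous fun x : Fin (h + 1) => B (h - max (x : ℕ) 1) :=
    continuous_of_discreteTopology
  exact (ENNReal.continuous_ofReal.comp (continuous_overallUtility v)).add
    (h1.comp continuous_snd)

/-- The entries whose payments are at most `h`. -/
def bounded (h : ℕ) : Set (Entry h) := (Set.univ.pi fun _ => Set.Iic (h : ℝ≥0)) ×ˢ Set.univ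

theorem isCompact_bounded : IsCompact (bounded h) := by
  refine (isCompact_univ_pi fun _ => ?_).prod isCompact_univ
  rw [← Set.Icc_bot]
  exact isCompact_Icc

/-- The empty schedule. -/
def empty (h : ℕ) : Entry h := (0, 0)

theorem toList_empty : toList (empty h) = [] := by simp [toList, empty]

theorem empty_mem_bounded : empty h ∈ bounded h := by
  simp [bounded, empty]

/-- Stagewise rationality caps payments: those of the first `j + 1` days total at most `(j + 1) * v
≤ h`. Hence a compact space holds all schedules that matter. -/
theorem exists_toList_eq {s : List ℝ≥0} (hs : s.length ≤ h) {v : ℝ} (hv : v ≤ 1)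
    (hIR : StagewiseIR s v) : ∃ e ∈ bounded h, toList e = s := by
  refine ⟨(fun j => s.getD j 0, ⟨s.length, Nat.lt_succ_of_le hs⟩), ?_, ?_⟩
  · simp only [bounded, Set.mem_prod, Set.mem_univ, and_true, Set.mem_univ_pi, Set.mem_Iic]
    intro j
    rcases lt_or_ge (j : ℕ) s.length with hj | hj
    · have h1 := hIR (j + 1) (by omega) hj
      rw [cumulativeUtility, ← NNReal.coe_list_sum] at h1
      have h2 : s[(j : ℕ)] ≤ (s.take (j + 1)).sum := by
        refine List.single_le_sum (by simp) _ ?_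
        rw [List.mem_take_iff_getElem]
        exact ⟨j, by omega, rfl⟩
      have h3 : ((j + 1 : ℕ) : ℝ) * v ≤ h := by
        have : ((j + 1 : ℕ) : ℝ) ≤ h := by exact_mod_cast j.2
        have h0 : (0 : ℝ) ≤ ((j + 1 : ℕ) : ℝ) := Nat.cast_nonneg _
        nlinarith
      rw [List.getD_eq_getElem _ _ hj, ← NNReal.coe_le_coe]
      have : ((s[(j : ℕ)] : ℝ≥0) : ℝ) ≤ ((s.take (j + 1)).sum : ℝ≥0) := NNReal.coe_le_coe.2 h2
      push_cast at *
      linarith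
    · rw [List.getD_eq_default _ _ hj]
      exact zero_le
  · refine List.ext_getElem ?_ ?_
    · rw [length_toList]
    · intro i h1 h2
      simp only [toList, List.getElem_take, List.getElem_ofFn, List.getD_eq_getElem _ _ h2]

/-! ### Optimal choices from a compact menu -/

/-- `e` maximizes the overall utility among the acceptable entries of the menu `S`. -/
def IsBest (S : Set (Entry h)) (v : ℝ) (e : Entry h) : Prop :=
  e ∈ S ∧ StagewiseIR (toList e) v ∧
    ∀ e' ∈ S, StagewiseIR (toList e') v →
      overallUtility (toList e') v ≤ overallUtility (toList e) v

theorem exists_isBest {S : Set (Entry h)} (hS : IsCompact S) (h0 : empty h ∈ S) (v : ℝ) :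
    ∃ e, IsBest S v e := by
  obtain ⟨e, he, hm⟩ := (hS.inter_right (isClosed_stagewiseIR v)).exists_isMaxOn
    ⟨empty h, h0, by change StagewiseIR _ v; rw [toList_empty]; exact stagewiseIR_nil v⟩
    (continuous_overallUtility v).continuousOn
  exact ⟨e, he.1, he.2, fun e' h1 h2 => hm ⟨h1, h2⟩⟩

theorem monotone_of_isBest {S : Set (Entry h)} {d : ℝ → Entry h} (hd : ∀ v, IsBest S v (d v)) :
    Monotone fun v => overallUtility (toList (d v)) v := by
  intro v w hvw
  exact (overallUtility_mono _ hvw).trans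
    ((hd w).2.2 _ (hd v).1 (stagewiseIR_mono hvw (hd v).2.1))

/-- Length `x` is optimal iff some entry of length `x` is acceptable, which describes an upper set
of valuations, and the best utility from such entries reaches the overall best, which compares two
monotone functions. Adding the empty entry to `S'` ensures that its best choice always exists. -/
theorem measurableSet_exists_isBest {S : Set (Entry h)} (hS : IsCompact S) (h0 : empty h ∈ S)
    (x : Fin (h + 1)) : MeasurableSet {v | ∃ e, IsBest S v e ∧ e.2 = x} := by
  choose d hd using exists_isBest hS h0
  set S' : Set (Entry h) := insert (empty h) (S ∩ {e | e.2 = x}) with hS'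
  have hcS' : IsCompact S' := by
    refine (hS.inter_right ?_).insert _
    exact (isClosed_discrete {x}).preimage continuous_snd
  choose d' hd' using exists_isBest hcS' (Set.mem_insert _ _)
  have hD : MeasurableSet {v | ∃ e ∈ S, e.2 = x ∧ StagewiseIR (toList e) v} := by
    refine Set.OrdConnected.measurableSet (IsUpperSet.ordConnected ?_)
    rintro v w hvw ⟨e, he, hx, hIR⟩
    exact ⟨e, he, hx, stagewiseIR_mono hvw hIR⟩
  have : {v | ∃ e, IsBest S v e ∧ e.2 = x} =
      {v | ∃ e ∈ S, e.2 = x ∧ StagewiseIR (toList e) v} ∩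
        {v | overallUtility (toList (d v)) v ≤ overallUtility (toList (d' v)) v} := by
    ext v
    constructor
    · rintro ⟨e, he, hx⟩
      refine ⟨⟨e, he.1, hx, he.2.1⟩, ?_⟩
      exact (he.2.2 _ (hd v).1 (hd v).2.1).trans
        ((hd' v).2.2 e (Set.mem_insert_of_mem _ ⟨he.1, hx⟩) he.2.1)
    · rintro ⟨⟨e, he, hx, hIR⟩, hle⟩
      rcases (hd' v).1 with h1 | h1
      · refine ⟨e, ⟨he, hIR, fun e' he' hIR' => ((hd v).2.2 e' he' hIR').trans (hle.trans ?_)⟩, hx⟩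
        rw [h1, toList_empty, overallUtility_nil]
        exact overallUtility_nonneg_of_stagewiseIR hIR
      · exact ⟨d' v, ⟨h1.1, (hd' v).2.1, fun e' he' hIR' =>
          ((hd v).2.2 e' he' hIR').trans hle⟩, h1.2⟩
  rw [this]
  exact hD.inter (measurableSet_le (monotone_of_isBest hd).measurable
    (monotone_of_isBest hd').measurable)

/-- A measurable selection of optimal choices, with ties broken in favor of the lengths of large
weight. -/
theorem exists_measurable_selection {S : Set (Entry h)} (hS : IsCompact S) (h0 : empty h ∈ S)
    (w : Fin (h + 1) → ℝ≥0∞) :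
    ∃ d : ℝ → Entry h, (∀ v, IsBest S v (d v)) ∧ (∀ v e, IsBest S v e → w e.2 ≤ w (d v).2) ∧
      (Measurable fun v => (d v).2) ∧ Measurable fun v => overallUtility (toList (d v)) v := by
  -- The chosen length will depend only on the set of optimal lengths, which takes finitely many
  -- values; this gives measurability.
  have hG : ∀ p : Fin (h + 1) → Prop, ∃ x, (∃ y, p y) → p x ∧ ∀ y, p y → w y ≤ w x := by
    intro p
    by_cases hp : ∃ y, p y
    · obtain ⟨x, hx, hm⟩ := Set.exists_max_image {x | p x} w (Set.toFinite _) hp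
      exact ⟨x, fun _ => ⟨hx, hm⟩⟩
    · exact ⟨0, fun hc => absurd hc hp⟩
  choose G hG using hG
  set E : ℝ → Fin (h + 1) → Prop := fun v x => ∃ e, IsBest S v e ∧ e.2 = x with hE
  have hEm : Measurable E :=
    measurable_pi_lambda _ fun x => (measurableSet_exists_isBest hS h0 x).mem
  have hex : ∀ v, ∃ x, E v x := fun v => by
    obtain ⟨e, he⟩ := exists_isBest hS h0 v
    exact ⟨e.2, e, he, rfl⟩
  choose d hd hdx using fun v => (hG (E v) (hex v)).1
  refine ⟨d, hd, ?_, ?_, (monotone_of_isBest hd).measurable⟩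
  · intro v e he
    rw [hdx]
    exact (hG (E v) (hex v)).2 _ ⟨e, he, rfl⟩
  · simp only [hdx]
    exact (Measurable.of_discrete (f := G)).comp hEm

end Entry

/-! ### Optimal stagewise auctions -/

/-- The values that auctions of up to `h` units attain, if the asset is worth `B j` when it is
available with `j` days remaining. -/
def stageValues (B : ℕ → ℝ≥0∞) (h : ℕ) : Set ℝ≥0∞ :=
  {r | ∃ (A : StagewiseAuction h) (τ : ℝ → Option A.bids),
    (∀ v ∈ Set.Icc (0 : ℝ) 1, A.IsOptimalBid v (τ v)) ∧
      r = ∫⁻ v, stageValue B h (A.outcome (τ v)) v ∂uniform01}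

/-- The auction in which an agent reports a valuation `b` and gets the schedule `d b`. -/
noncomputable def directAuction {h : ℕ} (d : ℝ → Entry h) : StagewiseAuction h where
  bids := Set.univ
  schedule b := (d (b : ℝ≥0)).toList
  length_le b := by
    rw [Entry.length_toList]
    exact Nat.lt_succ_iff.1 (d _).2.2

/-- Agents with nonnegative valuations report them truthfully. -/
noncomputable def truthfulStrategy {h : ℕ} (d : ℝ → Entry h) (v : ℝ) :
    Option (directAuction d).bids :=
  if 0 ≤ v then some ⟨v.toNNReal, Set.mem_univ _⟩ else none

theorem directAuction_outcome {h : ℕ} {S : Set (Entry h)} {d : ℝ → Entry h}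
    (hd : ∀ v, Entry.IsBest S v (d v)) (v : ℝ) :
    (directAuction d).outcome (truthfulStrategy d v) = (d v).toList := by
  unfold truthfulStrategy
  split_ifs with hv
  · change (d (v.toNNReal : ℝ≥0)).toList = _
    rw [Real.coe_toNNReal v hv]
  -- A negative valuation cannot accept a first day at a nonnegative price, so `d v` describes the
  -- empty schedule too.
  · change [] = _
    symm
    rw [← List.length_eq_zero_iff]
    by_contra hc
    have := (hd v).2.1 1 le_rfl (Nat.pos_of_ne_zero hc)
    rw [cumulativeUtility, ← NNReal.coe_list_sum] at this
    have h0 : (0 : ℝ) ≤ (((d v).toList.take 1).sum : ℝ≥0) := NNReal.coe_nonneg _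
    push_cast at *
    linarith

theorem isOptimalBid_truthfulStrategy {h : ℕ} {S : Set (Entry h)} (h0 : Entry.empty h ∈ S)
    {d : ℝ → Entry h} (hd : ∀ v, Entry.IsBest S v (d v)) (v : ℝ) :
    (directAuction d).IsOptimalBid v (truthfulStrategy d v) := by
  refine ⟨?_, fun b' hb' => ?_⟩
  · rw [directAuction_outcome hd]
    exact (hd v).2.1
  · rw [directAuction_outcome hd]
    cases b' with
    | none =>
      have := (hd v).2.2 _ h0
      rw [Entry.toList_empty] at this
      exact this hb'
    | some b => exact (hd v).2.2 _ (hd _).1 hb'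

theorem stageValue_le {B : ℕ → ℝ≥0∞} {h : ℕ} {s : List ℝ≥0} {v : ℝ}
    (hv : v ∈ Set.Icc (0 : ℝ) 1) :
    stageValue B h s v ≤ ENNReal.ofReal s.length + B (h - max s.length 1) := by
  refine add_le_add (ENNReal.ofReal_le_ofReal ?_) le_rfl
  rw [overallUtility_eq]
  have h1 : (0 : ℝ) ≤ (s.sum : ℝ≥0) := NNReal.coe_nonneg _
  have h2 : (s.length : ℝ) * v ≤ s.length := mul_le_of_le_one_right (Nat.cast_nonneg _) hv.2
  linarith

/-- For almost every valuation, the best choice from the limit of a sequence of menus is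
at least as good for the designer as the limit of the choices. -/
theorem limsup_stageValue_le {B : ℕ → ℝ≥0∞} {h : ℕ} {S : ℕ → Set (Entry h)}
    (hSK : ∀ n, S n ⊆ Entry.bounded h)
    (hlim : ∀ e ∈ upperLimit S, ∀ U ∈ 𝓝 e, ∀ᶠ n in atTop, (S n ∩ U).Nonempty)
    {d : ℝ → Entry h} (hd : ∀ v, Entry.IsBest (upperLimit S) v (d v))
    (hdw : ∀ v e, Entry.IsBest (upperLimit S) v e →
      B (h - max (e.2 : ℕ) 1) ≤ B (h - max ((d v).2 : ℕ) 1))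
    {v : ℝ} (hv : ContinuousAt (fun v => overallUtility (d v).toList v) v)
    {c : ℕ → Entry h} (hc : ∀ n, Entry.IsBest (S n) v (c n)) :
    limsup (fun n => stageValue B h (c n).toList v) atTop ≤ stageValue B h (d v).toList v := by
  by_contra! hlt
  obtain ⟨r, hr1, hr2⟩ := exists_between hlt
  obtain ⟨ψ, hψ, hψr⟩ := extraction_of_frequently_atTop (frequently_lt_of_lt_limsup (by isBoundedDefault) hr2)
  obtain ⟨e, -, ρ, hρ, he⟩ := Entry.isCompact_bounded.tendsto_subseq
    (x := fun n => c (ψ n)) (fun n => hSK _ (hc _).1)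
  have hψρ : StrictMono (ψ ∘ ρ) := hψ.comp hρ
  have heT : e ∈ upperLimit S :=
    mem_upperLimit_of_tendsto hψρ (fun n => (hc (ψ (ρ n))).1) he
  have heIR : StagewiseIR e.toList v :=
    (Entry.isClosed_stagewiseIR v).mem_of_tendsto he
      (Eventually.of_forall fun n => (hc (ψ (ρ n))).2.1)
  have hu : Tendsto (fun n => overallUtility (c (ψ (ρ n))).toList v) atTop
      (𝓝 (overallUtility e.toList v)) :=
    (Entry.continuous_overallUtility v).continuousAt.tendsto.comp he
  -- The choice of a lower type `v'` is a limit of menu entries, which `v` eventually accepts thanks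
  -- to the slack; so `c` does at least as well in the limit. Letting `v'` increase to `v` uses
  -- continuity of the utility at `v`.
  have hlt' : ∀ v' < v, overallUtility (d v').toList v' ≤ overallUtility e.toList v := by
    intro v' hv'
    refine (Entry.overallUtility_mono _ hv'.le).trans (le_of_forall_lt fun t ht => ?_)
    obtain ⟨t', ht, ht'⟩ := exists_between ht
    refine ht.trans_le (ge_of_tendsto hu ?_)
    have hU : ∀ᶠ e' in 𝓝 (d v'), StagewiseIR e'.toList v ∧ t' < overallUtility e'.toList v :=
      (Entry.eventually_stagewiseIR hv' (hd v').2.1).and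
        ((Entry.continuous_overallUtility v).continuousAt.eventually_const_lt ht')
    filter_upwards [hψρ.tendsto_atTop.eventually (hlim _ (hd v').1 _ hU)] with n hn
    obtain ⟨e', he', h1, h2⟩ := hn
    exact h2.le.trans ((hc _).2.2 e' he' h1)
  have hle : overallUtility (d v).toList v ≤ overallUtility e.toList v := by
    have : Tendsto (fun v' => overallUtility (d v').toList v') (𝓝[<] v)
        (𝓝 (overallUtility (d v).toList v)) := hv.tendsto.mono_left nhdsWithin_le_nhds
    exact le_of_tendsto this (eventually_nhdsWithin_of_forall hlt')
  have hbest : Entry.IsBest (upperLimit S) v e :=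
    ⟨heT, heIR, fun e' h1 h2 => ((hd v).2.2 e' h1 h2).trans hle⟩
  have h1 : r ≤ stageValue B h e.toList v :=
    ge_of_tendsto ((Entry.continuous_stageValue B v).continuousAt.tendsto.comp he)
      (Eventually.of_forall fun n => (hψr (ρ n)).le)
  have h2 : stageValue B h e.toList v ≤ stageValue B h (d v).toList v := by
    refine add_le_add (ENNReal.ofReal_le_ofReal ((hd v).2.2 e heT heIR)) ?_
    rw [Entry.length_toList, Entry.length_toList]
    exact hdw v e hbest
  exact absurd (h1.trans h2) (not_le.2 hr1)

/-- There is an optimal stagewise auction. -/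
theorem exists_optimal_stage (B : ℕ → ℝ≥0∞) (hB : ∀ j, B j ≠ ∞) (h : ℕ) :
    ∃ (A : StagewiseAuction h) (τ : ℝ → Option A.bids),
      (∀ v, A.IsOptimalBid v (τ v)) ∧
      (Measurable fun v => (A.outcome (τ v)).length) ∧
      (Measurable fun v => overallUtility (A.outcome (τ v)) v) ∧
      ∫⁻ v, stageValue B h (A.outcome (τ v)) v ∂uniform01 = sSup (stageValues B h) := by
  have hne : (stageValues B h).Nonempty := by
    have hS : IsCompact ({Entry.empty h} : Set (Entry h)) := isCompact_singleton
    choose d hd using Entry.exists_isBest hS (Set.mem_singleton _)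
    exact ⟨_, directAuction d, truthfulStrategy d,
      fun v _ => isOptimalBid_truthfulStrategy (Set.mem_singleton _) hd v, rfl⟩
  obtain ⟨r, -, hr, hrmem⟩ := exists_seq_tendsto_sSup hne (OrderTop.bddAbove _)
  choose A τ hτ hrA using hrmem
  set S : ℕ → Set (Entry h) := fun n =>
    Entry.bounded h ∩ {e | ∃ b, e.toList = (A n).outcome b} with hS
  have hSK : ∀ n, S n ⊆ Entry.bounded h := fun n => Set.inter_subset_left
  have hS0 : ∀ n, Entry.empty h ∈ S n := fun n =>
    ⟨Entry.empty_mem_bounded, none, Entry.toList_empty⟩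
  obtain ⟨φ, hφ, hlim⟩ := exists_subseq_upperLimit S
  set T := upperLimit (S ∘ φ) with hT
  have hTc : IsCompact T := Entry.isCompact_bounded.of_isClosed_subset (isClosed_upperLimit _)
    (upperLimit_subset Entry.isCompact_bounded.isClosed fun n => hSK _)
  have hT0 : Entry.empty h ∈ T :=
    mem_upperLimit_of_tendsto (S := S ∘ φ) strictMono_id (fun n => hS0 _) tendsto_const_nhds
  obtain ⟨d, hd, hdw, hdl, hdu⟩ :=
    Entry.exists_measurable_selection hTc hT0 fun x => B (h - max (x : ℕ) 1)
  have hout := directAuction_outcome hd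
  have hopt := isOptimalBid_truthfulStrategy hT0 hd
  refine ⟨directAuction d, truthfulStrategy d, hopt, ?_, ?_, le_antisymm ?_ ?_⟩
  · simp only [hout, Entry.length_toList]
    exact (Measurable.of_discrete (f := fun x : Fin (h + 1) => (x : ℕ))).comp hdl
  · simpa only [hout] using hdu
  · exact le_sSup ⟨directAuction d, truthfulStrategy d, fun v _ => hopt v, rfl⟩
  · simp only [hout]
    have hcount : {v | ¬ ContinuousAt (fun v => overallUtility (d v).toList v) v}.Countable :=
      (Entry.monotone_of_isBest hd).countable_not_continuousAt
    have hae : ∀ᵐ v ∂uniform01, ContinuousAt (fun v => overallUtility (d v).toList v) v :=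
      ae_restrict_of_ae (ae_iff.2 (hcount.measure_zero volume))
    have hent : ∀ n, ∀ v ∈ Set.Icc (0 : ℝ) 1, ∃ e, Entry.IsBest (S n) v e ∧
        e.toList = (A n).outcome (τ n v) := by
      intro n v hv
      obtain ⟨e, heK, he⟩ := Entry.exists_toList_eq ((A n).length_outcome_le (τ n v)) hv.2
        (hτ n v hv).1
      refine ⟨e, ⟨⟨heK, _, he⟩, he ▸ (hτ n v hv).1, ?_⟩, he⟩
      rintro e' ⟨-, b, hb⟩ hIR
      rw [he, hb]
      exact (hτ n v hv).2 b (hb ▸ hIR)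
    -- The strategies `τ n` may be nonmeasurable; measurable minorants with the same integral make
    -- the reverse Fatou lemma applicable.
    choose g hgm hgle hgi using fun n => exists_measurable_le_lintegral_eq uniform01
      (fun v => stageValue B h ((A (φ n)).outcome (τ (φ n) v)) v)
    have hbd : ∀ n, g n ≤ᵐ[uniform01] fun _ =>
        ENNReal.ofReal h + ∑ j ∈ Finset.range (h + 1), B j := by
      intro n
      filter_upwards [ae_mem_Icc_uniform01] with v hv
      have hl := (A (φ n)).length_outcome_le (τ (φ n) v)
      refine (hgle n v).trans ((stageValue_le hv).trans (add_le_add ?_ ?_))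
      · exact ENNReal.ofReal_le_ofReal (Nat.cast_le.2 hl)
      · exact Finset.single_le_sum (f := B) (fun _ _ => zero_le) (Finset.mem_range.2 (by omega))
    have hfin : ∫⁻ _, ENNReal.ofReal h + ∑ j ∈ Finset.range (h + 1), B j ∂uniform01 ≠ ∞ := by
      simp only [lintegral_const, measure_univ, mul_one]
      exact ENNReal.add_ne_top.2 ⟨ENNReal.ofReal_ne_top, ENNReal.sum_ne_top.2 fun j _ => hB j⟩
    calc sSup (stageValues B h) = limsup (fun n => ∫⁻ v, g n v ∂uniform01) atTop := by
          rw [← (hr.comp hφ.tendsto_atTop).limsup_eq]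
          congr 1
          funext n
          rw [← hgi n, Function.comp, hrA]
      _ ≤ ∫⁻ v, limsup (fun n => g n v) atTop ∂uniform01 := limsup_lintegral_le _ hgm hbd hfin
      _ ≤ _ := by
          refine lintegral_mono_ae ?_
          filter_upwards [hae, ae_mem_Icc_uniform01] with v hv hv1
          choose c hc hce using fun n => hent (φ n) v hv1
          refine le_trans (limsup_le_limsup (Eventually.of_forall fun n => ?_))
            (limsup_stageValue_le (S := S ∘ φ) (fun n => hSK _) hlim hd hdw hv hc)
          rw [hce]
          exact hgle n v

/-! ### The value of the rental game -/

/-- The optimal expected reward from the last `h` days. -/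
noncomputable def gameValue (h : ℕ) : ℝ≥0∞ :=
  match h with
  | 0 => 0
  -- The case split and `min` serve only termination: a stage with `k + 1` days left continues with
  -- at most `k`.
  | k + 1 => sSup (stageValues (fun j => if j ≤ k then gameValue (min j k) else 0) (k + 1))
  termination_by h
  decreasing_by omega

theorem stageValue_congr {B B' : ℕ → ℝ≥0∞} {h : ℕ} (h1 : 1 ≤ h) (hB : ∀ j < h, B j = B' j)
    (s : List ℝ≥0) (v : ℝ) : stageValue B h s v = stageValue B' h s v := by
  rw [stageValue, stageValue, hB _ (by omega)]

theorem gameValue_eq {h : ℕ} (h1 : 1 ≤ h) : gameValue h = sSup (stageValues gameValue h) := by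
  obtain ⟨k, rfl⟩ := Nat.exists_eq_add_of_le' h1
  rw [gameValue]
  congr 1
  have : ∀ s v, stageValue (fun j => if j ≤ k then gameValue (min j k) else 0) (k + 1) s v =
      stageValue gameValue (k + 1) s v :=
    stageValue_congr h1 fun j hj => by
      have : j ≤ k := by omega
      simp [this]
  simp only [stageValues, this]

theorem lintegral_stageValue_le_gameValue {h : ℕ} (h1 : 1 ≤ h) {A : StagewiseAuction h}
    {τ : ℝ → Option A.bids} (hτ : ∀ v ∈ Set.Icc (0 : ℝ) 1, A.IsOptimalBid v (τ v)) :
    ∫⁻ v, stageValue gameValue h (A.outcome (τ v)) v ∂uniform01 ≤ gameValue h := by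
  rw [gameValue_eq h1]
  exact le_sSup ⟨A, τ, hτ, rfl⟩

theorem gameValue_le (h : ℕ) : gameValue h ≤ h := by
  induction h using Nat.strong_induction_on with
  | _ h ih =>
    rcases Nat.eq_zero_or_pos h with rfl | h1
    · rw [gameValue]; simp
    rw [gameValue_eq h1]
    refine sSup_le ?_
    rintro _ ⟨A, τ, -, rfl⟩
    calc _ ≤ ∫⁻ _, (h : ℝ≥0∞) ∂uniform01 := by
          refine lintegral_mono_ae ?_
          filter_upwards [ae_mem_Icc_uniform01] with v hv
          have hl := A.length_outcome_le (τ v)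
          refine (stageValue_le hv).trans ((add_le_add_right (ih _ (by omega)) _).trans ?_)
          rw [ENNReal.ofReal_natCast]
          exact_mod_cast (by omega :
            (A.outcome (τ v)).length + (h - max (A.outcome (τ v)).length 1) ≤ h)
      _ = h := by simp

theorem gameValue_ne_top (h : ℕ) : gameValue h ≠ ∞ :=
  ((gameValue_le h).trans_lt (ENNReal.natCast_lt_top h)).ne

theorem isGreatest_rentalRewards (n : ℕ) :
    IsGreatest (rentalRewards n) (gameValue n).toReal := by
  choose A τ hopt hl hu hI using exists_optimal_stage gameValue gameValue_ne_top
  constructor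
  · refine mem_achievableRewards_of_schedule gameValue A τ trivial (fun h v _ => hopt h v) hu hl
      (fun h v => (hopt h v).overallUtility_nonneg) ?_ (fun h h1 => ?_) n (gameValue_ne_top n)
    · rw [gameValue]
    · rw [hI, gameValue_eq h1]
  · intro r hr
    exact le_of_mem_achievableRewards gameValue
      (fun M σ _ hσ h H h1 => lintegral_stageValue_le_gameValue h1 (hσ h H)) n
      (gameValue_ne_top n) hr

/-! ### Asymptotics -/

/-- The auction with a single bid, which rents the asset for all `k + 1` days, to be paid for by
`t` on the first of them. -/
def upfrontAuction (t : ℝ≥0) (k : ℕ) : StagewiseAuction (k + 1) where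
  bids := {0}
  schedule _ := t :: List.replicate k 0
  length_le _ := by simp

/-- Agents accept the upfront payment `t` if their valuation is at least `t`. -/
noncomputable def upfrontStrategy (t : ℝ≥0) (k : ℕ) (v : ℝ) : Option (upfrontAuction t k).bids :=
  if t ≤ v then some ⟨0, Set.mem_singleton 0⟩ else none

theorem cumulativeUtility_upfront (t : ℝ≥0) (k : ℕ) (v : ℝ) {i : ℕ} (hi : 1 ≤ i) :
    cumulativeUtility (t :: List.replicate k 0) v i = i * v - t := by
  obtain ⟨j, rfl⟩ := Nat.exists_eq_add_of_le' hi
  simp [cumulativeUtility, List.take_replicate]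

theorem overallUtility_upfront (t : ℝ≥0) (k : ℕ) (v : ℝ) :
    overallUtility (t :: List.replicate k 0) v = (k + 1) * v - t := by
  rw [overallUtility, cumulativeUtility_upfront _ _ _ (by simp)]
  simp

theorem upfrontAuction_outcome (t : ℝ≥0) (k : ℕ) (v : ℝ) :
    (upfrontAuction t k).outcome (upfrontStrategy t k v) =
      if t ≤ v then t :: List.replicate k 0 else [] := by
  unfold upfrontStrategy
  split_ifs <;> rfl

/-- Only the first day binds, as later days are free. A valuation below `t` fails there even when
the whole rental would be profitable. -/
theorem isOptimalBid_upfrontStrategy (t : ℝ≥0) (k : ℕ) {v : ℝ} (hv : 0 ≤ v) :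
    (upfrontAuction t k).IsOptimalBid v (upfrontStrategy t k v) := by
  rw [StagewiseAuction.IsOptimalBid, upfrontAuction_outcome]
  split_ifs with h
  · have hIR : ∀ i : ℕ, 1 ≤ i → 0 ≤ i * v - t := by
      intro i hi
      have : v ≤ i * v := le_mul_of_one_le_left hv (by exact_mod_cast hi)
      linarith
    refine ⟨fun i hi _ => ?_, ?_⟩
    · rw [cumulativeUtility_upfront _ _ _ hi]
      exact hIR i hi
    · rintro (_ | b) _
      · change overallUtility [] v ≤ _
        rw [overallUtility_nil, overallUtility_upfront]
        exact_mod_cast hIR (k + 1) (by omega)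
      · exact le_rfl
  · refine ⟨stagewiseIR_nil v, ?_⟩
    rintro (_ | b) hb
    · exact le_rfl
    · have h1 := hb 1 le_rfl (by simp [StagewiseAuction.outcome, upfrontAuction])
      change 0 ≤ cumulativeUtility (t :: List.replicate k 0) v 1 at h1
      rw [cumulativeUtility_upfront _ _ _ le_rfl] at h1
      push_cast at h1
      exact absurd (by linarith) h

/-- With probability `1 - t` the agent accepts and gains `(k + 1) * v - t ≥ k * t`; with probability
`t` one day is lost. -/
theorem gameValue_succ_ge {t : ℝ≥0} (ht1 : (t : ℝ) ≤ 1) (k : ℕ) :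
    (1 - t : ℝ) * (k * t) + t * (gameValue k).toReal ≤ (gameValue (k + 1)).toReal := by
  have ht0 : (0 : ℝ) ≤ t := t.2
  have hkt : 0 ≤ (k : ℝ) * t := mul_nonneg (Nat.cast_nonneg _) ht0
  have h1 := lintegral_stageValue_le_gameValue (h := k + 1) (by omega)
    (A := upfrontAuction t k) (τ := upfrontStrategy t k)
    fun v hv => isOptimalBid_upfrontStrategy _ k hv.1
  have h2 : ENNReal.ofReal (k * t) * ENNReal.ofReal (1 - t) + gameValue k * ENNReal.ofReal t ≤
      ∫⁻ v, stageValue gameValue (k + 1) ((upfrontAuction t k).outcome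
        (upfrontStrategy t k v)) v ∂uniform01 := by
    have hvol1 : uniform01 (Set.Ici (t : ℝ)) = ENNReal.ofReal (1 - t) := by
      rw [uniform01, Measure.restrict_apply measurableSet_Ici]
      have : Set.Ici (t : ℝ) ∩ Set.Icc 0 1 = Set.Icc (t : ℝ) 1 := by
        ext v
        simp only [Set.mem_inter_iff, Set.mem_Ici, Set.mem_Icc]
        exact ⟨fun h => ⟨h.1, h.2.2⟩, fun h => ⟨h.1, ht0.trans h.1, h.2⟩⟩
      rw [this, Real.volume_Icc]
    have hvol2 : uniform01 (Set.Iio (t : ℝ)) = ENNReal.ofReal t := by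
      rw [uniform01, Measure.restrict_apply measurableSet_Iio]
      have : Set.Iio (t : ℝ) ∩ Set.Icc 0 1 = Set.Ico 0 (t : ℝ) := by
        ext v
        simp only [Set.mem_inter_iff, Set.mem_Iio, Set.mem_Icc, Set.mem_Ico]
        exact ⟨fun h => ⟨h.2.1, h.1⟩, fun h => ⟨h.2, h.1, h.2.le.trans ht1⟩⟩
      rw [this, Real.volume_Ico, sub_zero]
    rw [← hvol1, ← hvol2, ← lintegral_indicator_const measurableSet_Ici,
      ← lintegral_indicator_const measurableSet_Iio,
      ← lintegral_add_left (measurable_const.indicator measurableSet_Ici)]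
    refine lintegral_mono fun v => ?_
    rw [upfrontAuction_outcome]
    rcases le_or_gt (t : ℝ) v with h | h
    · rw [if_pos h, stageValue, overallUtility_upfront, Set.indicator_of_mem (Set.mem_Ici.2 h),
        Set.indicator_of_notMem (by simpa using h), add_zero]
      refine le_add_right (ENNReal.ofReal_le_ofReal ?_)
      have h3 : (k : ℝ) * t ≤ k * v := mul_le_mul_of_nonneg_left h (Nat.cast_nonneg _)
      change _ ≤ ((k : ℝ) + 1) * v - t
      linarith
    · rw [if_neg (not_le.2 h), stageValue, Set.indicator_of_notMem (by simpa using h),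
        Set.indicator_of_mem (Set.mem_Iio.2 h), zero_add]
      simp
  have h3 := ENNReal.toReal_mono (gameValue_ne_top _) (h2.trans h1)
  rw [ENNReal.toReal_add (ENNReal.mul_ne_top ENNReal.ofReal_ne_top ENNReal.ofReal_ne_top)
    (ENNReal.mul_ne_top (gameValue_ne_top k) ENNReal.ofReal_ne_top), ENNReal.toReal_mul,
    ENNReal.toReal_mul, ENNReal.toReal_ofReal hkt, ENNReal.toReal_ofReal (sub_nonneg.2 ht1),
    ENNReal.toReal_ofReal ht0] at h3
  linarith

/-- Inserting the ansatz `t * n - c` into the recursion `gameValue_succ_ge` requires `(1 - t) * c ≥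
t`, whence the constant. -/
theorem gameValue_ge {t : ℝ} (ht0 : 0 ≤ t) (ht1 : t < 1) (n : ℕ) :
    t * n - t / (1 - t) ≤ (gameValue n).toReal := by
  lift t to ℝ≥0 using ht0
  have hpos : (0 : ℝ) < 1 - t := by linarith
  induction n with
  | zero =>
    have : (0 : ℝ) ≤ t / (1 - t) := div_nonneg t.2 hpos.le
    have := (gameValue 0).toReal_nonneg
    simp only [Nat.cast_zero, mul_zero]
    linarith
  | succ k ih =>
    refine le_trans ?_ (gameValue_succ_ge ht1.le k)
    have h1 := mul_le_mul_of_nonneg_left ih t.2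
    have h2 : (t : ℝ) / (1 - t) * (1 - t) = t := div_mul_cancel₀ _ hpos.ne'
    push_cast
    nlinarith

theorem tendsto_gameValue_div :
    Tendsto (fun n : ℕ => (gameValue n).toReal / n) atTop (𝓝 1) := by
  have hle : ∀ n : ℕ, (gameValue n).toReal ≤ n := fun n => by
    have := ENNReal.toReal_mono (ENNReal.natCast_ne_top n) (gameValue_le n)
    simpa using this
  rw [tendsto_order]
  constructor
  · intro a ha
    obtain ⟨t, hat, ht1⟩ := exists_between (max_lt ha zero_lt_one)
    have ht0 : 0 ≤ t := (le_max_right _ _).trans hat.le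
    have hlim : Tendsto (fun n : ℕ => t - t / (1 - t) / n) atTop (𝓝 (t - 0)) :=
      tendsto_const_nhds.sub (tendsto_const_div_atTop_nhds_zero_nat _)
    rw [sub_zero] at hlim
    filter_upwards [hlim.eventually_const_lt ((le_max_left _ _).trans_lt hat),
      eventually_gt_atTop 0] with n hn hn0
    have hn' : (0 : ℝ) < n := by exact_mod_cast hn0
    refine hn.trans_le ?_
    rw [le_div_iff₀ hn', sub_mul, div_mul_cancel₀ _ hn'.ne']
    exact gameValue_ge ht0 ht1 n
  · intro a ha
    exact Eventually.of_forall fun n => (div_le_one_of_le₀ (hle n) (Nat.cast_nonneg n)).trans_lt ha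

theorem mainTheorem11 :
    ∃ R F : ℕ → ℝ,
      (∀ n : ℕ, IsGreatest (rentalRewards n) (R n)) ∧
      (∀ n : ℕ, IsGreatest (fixedRateRentalRewards n) (F n)) ∧
      (∀ n : ℕ, F n = (n : ℝ) / 2) ∧
      Tendsto (fun n : ℕ => R n / (n : ℝ)) atTop (𝓝 1) ∧
      Tendsto (fun n : ℕ => R n / F n) atTop (𝓝 2) := by
  refine ⟨fun n => (gameValue n).toReal, fun n => n / 2, isGreatest_rentalRewards,
    isGreatest_fixedRateRentalRewards, fun _ => rfl, tendsto_gameValue_div, ?_⟩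
  have := tendsto_gameValue_div.mul_const 2
  rw [one_mul] at this
  refine this.congr fun n => ?_
  rw [div_div_eq_mul_div, div_mul_eq_mul_div]
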